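/- All categories are locally small, and "small" means set-sized. Let $\lambda$ be a regular cardinal. A category is $\lambda$-filtered if every diagram in it with fewer than $\lambda$ morphisms has a cocone. An object $X$ of a category $\mathcal{A}$ is $\lambda$-presentable if $\mathcal{A}(X,-)\colon \mathcal{A}\to\mathsf{Set}$ preserves small $\lambda$-filtered colimits. The category $\mathcal{A}$ is locally $\lambda$-presentable if it has all small colimits and there is a small set of $\lambda$-presentable objects such that every object of $\mathcal{A}$ is a small $\lambda$-filtered colimit of objects of this set; $\mathcal{A}$ is locally presentable if it is locally $\lambda$-presentable for some regular cardinal $\lambda$. An endofunctor of a locally presentable category $\mathcal{A}$ is accessible if it preserves small $\lambda$-filtered colimits for some regular cardinal $\lambda$ (equivalently, for some regular $\lambda$ such that $\mathcal{A}$ is moreover locally $\lambda$-presentable). **Proposition.** Let $\mathcal{A}$ be a locally presentable category and let $(c,\epsilon,\delta)$ be a comonad on $\mathcal{A}$ whose underlying endofunctor $c\colon\mathcal{A}\to\mathcal{A}$ is accessible. Let $\mathcal{A}_c$ be the category of $c$-coalgebras: its objects are pairs $(a, h\colon a\to ca)$ with $\epsilon_a h = 1_a$ and $\delta_a h = c(h)\,h$,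 and its morphisms $(a,h)\to(a',h')$ are the morphisms $f\colon a\to a'$ of $\mathcal{A}$ with $h' f = c(f)\,h$. Then $\mathcal{A}_c$ is locally presentable. -/

import Mathlib

universe w u

open CategoryTheory

open Limits

namespace CategoryTheory.Comonad

variable {A : Type u} [Category.{w} A] (c : Comonad A) (κ : Cardinal.{w}) [Fact κ.IsRegular]

/-- A coalgebra is `κ`-presentable as soon as its carrier is, when the comonad is
`κ`-accessible. -/
lemma isCardinalPresentable_coalgebra [c.toFunctor.IsCardinalAccessible κ]
    (X : c.Coalgebra) [IsCardinalPresentable X.A κ] : IsCardinalPresentable X κ where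
  preservesColimitOfShape J _ _ := ⟨fun {F} ↦ ⟨fun {t} ht ↦ by
    have := isFiltered_of_isCardinalFiltered J κ
    have := essentiallySmall_of_small_of_locallySmall.{w} J
    have := c.toFunctor.preservesColimitsOfShape_of_isCardinalAccessible κ J
    have h₁ := isColimitOfPreserves c.forget ht
    have h₂ := isColimitOfPreserves c.toFunctor h₁
    refine ⟨Types.FilteredColimit.isColimitOf' _ _ (fun (x : X ⟶ t.pt) ↦ ?_)
      (fun i (x : X ⟶ F.obj i) (y : X ⟶ F.obj i) h ↦ ?_)⟩
    · obtain ⟨i, f, hf⟩ : ∃ (i : J) (f : X.A ⟶ (F.obj i).A), f ≫ (t.ι.app i).f = x.f :=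
        IsCardinalPresentable.exists_hom_of_isColimit κ h₁ x.f
      obtain ⟨j, u, hu⟩ := IsCardinalPresentable.exists_eq_of_isColimit' κ h₂
        (i := i) (X.a ≫ c.map f) (f ≫ (F.obj i).a) (by
          change (X.a ≫ c.map f) ≫ c.map (t.ι.app i).f =
            (f ≫ (F.obj i).a) ≫ c.map (t.ι.app i).f
          rw [Category.assoc, Category.assoc, ← Functor.map_comp, hf, x.h,
            (t.ι.app i).h, reassoc_of% hf]
          rfl)
      replace hu : (X.a ≫ c.map f) ≫ c.map (F.map u).f =
        (f ≫ (F.obj i).a) ≫ c.map (F.map u).f := hu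
      refine ⟨j, ({ f := f ≫ (F.map u).f, h := ?_ } : X ⟶ F.obj j), ?_⟩
      · rw [Functor.map_comp, ← Category.assoc, hu, Category.assoc, (F.map u).h, Category.assoc]
      · refine Coalgebra.Hom.ext ?_
        change x.f = (f ≫ (F.map u).f) ≫ (t.ι.app j).f
        rw [Category.assoc, ← Coalgebra.comp_f, t.w, hf]
    · replace h : x ≫ t.ι.app i = y ≫ t.ι.app i := h
      obtain ⟨j, u, hu⟩ := IsCardinalPresentable.exists_eq_of_isColimit' κ h₁ (i := i) x.f y.f
        (congr_arg Coalgebra.Hom.f h)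
      exact ⟨j, u, Coalgebra.Hom.ext hu⟩⟩⟩

/-- The coalgebras whose carrier is `κ`-presentable. -/
abbrev presentableCarrier : ObjectProperty c.Coalgebra :=
  (isCardinalPresentable A κ).inverseImage c.forget

instance essentiallySmall_presentableCarrier
    [ObjectProperty.EssentiallySmall.{w} (isCardinalPresentable A κ)] :
    ObjectProperty.EssentiallySmall.{w} (c.presentableCarrier κ) where
  exists_small_le' := by
    obtain ⟨Q, _, -, hQ⟩ :=
      ObjectProperty.EssentiallySmall.exists_small_le (isCardinalPresentable A κ)
    have : Small.{w} (Subtype Q) := ‹ObjectProperty.Small.{w} Q›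
    refine ⟨fun X ↦ Q X.A, ?_, fun X hX ↦ ?_⟩
    · let f : Subtype (fun X : c.Coalgebra ↦ Q X.A) →
          Σ a : Subtype Q, (a.1 ⟶ c.obj a.1) := fun X ↦ ⟨⟨X.1.A, X.2⟩, X.1.a⟩
      refine small_of_injective (f := f) ?_
      rintro ⟨⟨a, h, _, _⟩, _⟩ ⟨⟨a', h', _, _⟩, _⟩ eq
      simp only [f, Sigma.mk.injEq, Subtype.mk.injEq] at eq
      obtain ⟨rfl, eq⟩ := eq
      obtain rfl := eq_of_heq eq
      rfl
    · obtain ⟨a, ha, ⟨e⟩⟩ := hQ _ hX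
      replace e : X.A ≅ a := e
      let Z : c.Coalgebra :=
        { A := a
          a := e.inv ≫ X.a ≫ c.map e.hom
          counit := by
            rw [Category.assoc, Category.assoc, c.ε.naturality, X.counit_assoc]
            simp
          coassoc := by
            simp only [Category.assoc, Functor.map_comp, c.δ.naturality, X.coassoc_assoc]
            simp [← Functor.map_comp] }
      exact ⟨Z, ha, ⟨Coalgebra.isoMk e (by simp [Z])⟩⟩

variable {c}

variable {κ} in
/-- The colimit of a sequence of `κ`-presentable objects over `Y` such that each term has a
costructure map with values in the image by `c` of the next term is a coalgebra over `Y`. -/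
lemma exists_coalgebra_of_sequence [HasColimitsOfSize.{w, w} A] (hκ : Cardinal.aleph0 < κ)
    {Y : c.Coalgebra} {b : ℕ → A} (hb : ∀ n, IsCardinalPresentable (b n) κ)
    (f : ∀ n, b n ⟶ b (n + 1)) (k : ∀ n, b n ⟶ c.obj (b (n + 1))) (p : ∀ n, b n ⟶ Y.A)
    (counit : ∀ n, k n ≫ c.ε.app _ = f n)
    (comm : ∀ n, k n ≫ c.map (f (n + 1)) = f n ≫ k (n + 1))
    (coassoc : ∀ n, k n ≫ c.δ.app _ ≫ c.map (c.map (f (n + 1))) = k n ≫ c.map (k (n + 1)))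
    (f_p : ∀ n, f n ≫ p (n + 1) = p n) (k_map_p : ∀ n, k n ≫ c.map (p (n + 1)) = p n ≫ Y.a) :
    ∃ (Z : c.Coalgebra) (_ : IsCardinalPresentable Z.A κ) (π : Z ⟶ Y) (i : b 1 ⟶ Z.A),
      i ≫ π.f = p 1 ∧ k 0 ≫ c.map i = f 0 ≫ i ≫ Z.a := by
  have : HasColimitsOfSize.{0, 0} A := hasColimitsOfSizeShrink.{0, 0, w, w} A
  let D : ℕ ⥤ A := Functor.ofSequence f
  have : ∀ n, IsCardinalPresentable (D.obj n) κ := hb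
  obtain ⟨Z, i, hZ, hi, hext, hdesc⟩ : ∃ (Z : A) (i : ∀ n, b n ⟶ Z),
      IsCardinalPresentable Z κ ∧ (∀ n, f n ≫ i (n + 1) = i n) ∧
      (∀ ⦃T : A⦄ ⦃g g' : Z ⟶ T⦄, (∀ n, i n ≫ g = i n ≫ g') → g = g') ∧
      ∀ ⦃T : A⦄ (g : ∀ n, b n ⟶ T), (∀ n, f n ≫ g (n + 1) = g n) →
        ∃ g' : Z ⟶ T, ∀ n, i n ≫ g' = g n := by
    refine ⟨colimit D, colimit.ι D, ?_, fun n ↦ ?_, fun T g g' h ↦ colimit.hom_ext h,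
      fun T g hg ↦ ⟨colimit.desc D ⟨T, NatTrans.ofSequence g (fun n ↦ ?_)⟩,
        fun n ↦ colimit.ι_desc _ _⟩⟩
    · refine isCardinalPresentable_of_isColimit _ (colimit.isColimit D) κ ?_
      have : Countable (Arrow ℕ) :=
        (show Function.Injective (fun φ : Arrow ℕ ↦ (φ.left, φ.right)) from
          fun φ ψ h ↦ Arrow.ext (Prod.ext_iff.1 h).1 (Prod.ext_iff.1 h).2
            (Subsingleton.elim _ _)).countable
      exact (Cardinal.lift_le_aleph0.2 (Cardinal.mk_le_aleph0 (α := Arrow ℕ))).trans_lt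
        (by simpa using hκ)
    · have := colimit.w D (homOfLE (Nat.le_add_right n 1))
      rwa [Functor.ofSequence_map_homOfLE_succ] at this
    · rw [Functor.ofSequence_map_homOfLE_succ]
      exact (hg n).trans (Category.comp_id _).symm
  obtain ⟨a, ha⟩ := hdesc (fun n ↦ k n ≫ c.map (i (n + 1))) (fun n ↦ by
    rw [← reassoc_of% comm, ← Functor.map_comp, hi])
  obtain ⟨π, hπ⟩ := hdesc p f_p
  refine ⟨⟨Z, a, hext fun n ↦ ?_, hext fun n ↦ ?_⟩, hZ, ⟨π, hext fun n ↦ ?_⟩, i 1, hπ 1, ?_⟩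
  · have := c.ε.naturality (i (n + 1))
    dsimp at this
    rw [reassoc_of% ha, this, reassoc_of% counit, hi, Category.comp_id]
  · have := c.δ.naturality (i (n + 1))
    dsimp at this
    rw [reassoc_of% ha, reassoc_of% ha, this, ← Functor.map_comp, ha, Functor.map_comp,
      ← reassoc_of% coassoc, ← Functor.map_comp, ← Functor.map_comp, hi]
  · dsimp
    rw [reassoc_of% ha, ← Functor.map_comp, hπ, k_map_p, reassoc_of% hπ]
  · dsimp
    rw [reassoc_of% hi, ha]

/-- A partially defined coalgebra structure over a coalgebra `Y`: the costructure
map `k` on `src` takes values in the image by `c` of a larger object `tgt`. -/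
structure PartialCoalgebra (Y : c.Coalgebra) where
  src : A
  tgt : A
  presentable_src : IsCardinalPresentable src κ
  presentable_tgt : IsCardinalPresentable tgt κ
  f : src ⟶ tgt
  p : tgt ⟶ Y.A
  k : src ⟶ c.obj tgt
  k_map_p : k ≫ c.map p = f ≫ p ≫ Y.a
  k_counit : k ≫ c.ε.app tgt = f

namespace PartialCoalgebra

variable {κ} {Y : c.Coalgebra}

section

variable [c.toFunctor.IsCardinalAccessible κ] {J : Type w} [SmallCategory J]
  [IsCardinalFiltered J κ]

lemma exists_lift {D : J ⥤ A} {t : D ⟶ (Functor.const J).obj Y.A}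
    (ht : IsColimit (Cocone.mk Y.A t)) {b : A} [IsCardinalPresentable b κ] (q : b ⟶ Y.A) :
    ∃ (j : J) (f : b ⟶ D.obj j) (k : b ⟶ c.obj (D.obj j)), f ≫ t.app j = q ∧
      k ≫ c.map (t.app j) = q ≫ Y.a ∧ k ≫ c.ε.app (D.obj j) = f := by
  have := isFiltered_of_isCardinalFiltered J κ
  have := essentiallySmall_of_small_of_locallySmall.{w} J
  have := c.toFunctor.preservesColimitsOfShape_of_isCardinalAccessible κ J
  obtain ⟨j₁, f, hf⟩ := IsCardinalPresentable.exists_hom_of_isColimit κ ht q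
  obtain ⟨j₂, k, hk⟩ := IsCardinalPresentable.exists_hom_of_isColimit κ
    (isColimitOfPreserves c.toFunctor ht) (q ≫ Y.a)
  replace hf : f ≫ t.app j₁ = q := hf
  replace hk : k ≫ c.map (t.app j₂) = q ≫ Y.a := hk
  have ht' {i j : J} (u : i ⟶ j) : D.map u ≫ t.app j = t.app i := by simp
  obtain ⟨j, u, v, huv⟩ := IsCardinalPresentable.exists_eq_of_isColimit κ ht
    f (k ≫ c.ε.app (D.obj j₂)) (by
      change f ≫ t.app j₁ = (k ≫ c.ε.app _) ≫ t.app j₂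
      have := c.ε.naturality (t.app j₂)
      dsimp at this
      rw [hf, Category.assoc, ← this, reassoc_of% hk, Y.counit, Category.comp_id])
  refine ⟨j, f ≫ D.map u, k ≫ c.map (D.map v), ?_, ?_, ?_⟩
  · rw [Category.assoc, ht', hf]
  · rw [Category.assoc, ← Functor.map_comp, ht', hk]
  · have := c.ε.naturality (D.map v)
    dsimp at this
    rw [huv, Category.assoc, Category.assoc, this]

end

/-- The compatibilities satisfied by two consecutive partial coalgebras, where the target
of the first is the source of the second. -/
structure Extends (S : PartialCoalgebra κ Y) {b : A} (f : S.tgt ⟶ b) (p : b ⟶ Y.A)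
    (k : S.tgt ⟶ c.obj b) : Prop where
  f_p : f ≫ p = S.p
  k_map_p : k ≫ c.map p = f ≫ p ≫ Y.a
  k_counit : k ≫ c.ε.app b = f
  comm : S.k ≫ c.map f = S.f ≫ k
  coassoc : S.k ≫ c.δ.app S.tgt ≫ c.map (c.map f) = S.k ≫ c.map k

variable [IsCardinalLocallyPresentable A κ] [c.toFunctor.IsCardinalAccessible κ]

lemma exists_extends (S : PartialCoalgebra κ Y) :
    ∃ (b : A) (_ : IsCardinalPresentable b κ) (f : S.tgt ⟶ b) (p : b ⟶ Y.A)
      (k : S.tgt ⟶ c.obj b), S.Extends f p k := by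
  obtain ⟨J, _, _, ⟨P⟩⟩ :=
    (isCardinalFilteredGenerator_isCardinalPresentable A κ).exists_colimitsOfShape Y.A
  have := isFiltered_of_isCardinalFiltered J κ
  have := essentiallySmall_of_small_of_locallySmall.{w} J
  have := c.toFunctor.preservesColimitsOfShape_of_isCardinalAccessible κ J
  have := S.presentable_src
  have := S.presentable_tgt
  obtain ⟨D, t, ht, hD⟩ : ∃ (D : J ⥤ A) (t : D ⟶ (Functor.const J).obj Y.A)
      (_ : IsColimit (Cocone.mk Y.A t)), ∀ j, IsCardinalPresentable (D.obj j) κ :=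
    ⟨P.diag, P.ι, P.isColimit, P.prop_diag_obj⟩
  have ht' {i j : J} (u : i ⟶ j) : D.map u ≫ t.app j = t.app i := by simp
  obtain ⟨j, f, k, hf, hk, hε⟩ := exists_lift (κ := κ) ht S.p
  have hc := isColimitOfPreserves c.toFunctor ht
  obtain ⟨j₁, u₁, hu₁⟩ := IsCardinalPresentable.exists_eq_of_isColimit' κ hc (i := j)
    (S.k ≫ c.map f) (S.f ≫ k) (by
      change (S.k ≫ c.map f) ≫ c.map (t.app j) = (S.f ≫ k) ≫ c.map (t.app j)
      rw [Category.assoc, Category.assoc, ← Functor.map_comp, hf, hk, S.k_map_p])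
  obtain ⟨j₂, u₂, hu₂⟩ := IsCardinalPresentable.exists_eq_of_isColimit' κ
    (isColimitOfPreserves c.toFunctor hc) (i := j)
    (S.k ≫ c.δ.app S.tgt ≫ c.map (c.map f)) (S.k ≫ c.map k) (by
      change (S.k ≫ c.δ.app S.tgt ≫ c.map (c.map f)) ≫ c.map (c.map (t.app j)) =
        (S.k ≫ c.map k) ≫ c.map (c.map (t.app j))
      have := c.δ.naturality S.p
      dsimp at this
      simp only [Category.assoc]
      rw [← Functor.map_comp, ← Functor.map_comp, ← Functor.map_comp, hf, hk, ← this,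
        reassoc_of% S.k_map_p, Y.coassoc, Functor.map_comp, reassoc_of% S.k_map_p])
  replace hu₁ : (S.k ≫ c.map f) ≫ c.map (D.map u₁) = (S.f ≫ k) ≫ c.map (D.map u₁) := hu₁
  replace hu₂ : (S.k ≫ c.δ.app S.tgt ≫ c.map (c.map f)) ≫ c.map (c.map (D.map u₂)) =
    (S.k ≫ c.map k) ≫ c.map (c.map (D.map u₂)) := hu₂
  simp only [Category.assoc] at hu₁ hu₂
  obtain ⟨l, v₁, v₂, hv⟩ := IsFiltered.span u₁ u₂
  have hεl := c.ε.naturality (D.map (u₁ ≫ v₁))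
  dsimp at hεl
  refine ⟨D.obj l, hD l, f ≫ D.map (u₁ ≫ v₁), t.app l, k ≫ c.map (D.map (u₁ ≫ v₁)), ?_, ?_,
    ?_, ?_, ?_⟩
  · rw [Category.assoc, ht', hf]
  · rw [Category.assoc, Category.assoc, ← Functor.map_comp, reassoc_of% (ht' (u₁ ≫ v₁)), ht', hk,
      reassoc_of% hf]
  · rw [Category.assoc, hεl, reassoc_of% hε]
  · simp only [Functor.map_comp, reassoc_of% hu₁]
  · rw [hv]
    simp only [Functor.map_comp, reassoc_of% hu₂]

/-- A choice of extension of a partial coalgebra. -/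
noncomputable def next (S : PartialCoalgebra κ Y) : PartialCoalgebra κ Y where
  src := S.tgt
  tgt := S.exists_extends.choose
  presentable_src := S.presentable_tgt
  presentable_tgt := S.exists_extends.choose_spec.choose
  f := S.exists_extends.choose_spec.choose_spec.choose
  p := S.exists_extends.choose_spec.choose_spec.choose_spec.choose
  k := S.exists_extends.choose_spec.choose_spec.choose_spec.choose_spec.choose
  k_map_p := S.exists_extends.choose_spec.choose_spec.choose_spec.choose_spec.choose_spec.k_map_p
  k_counit := S.exists_extends.choose_spec.choose_spec.choose_spec.choose_spec.choose_spec.k_counit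

lemma extends_next (S : PartialCoalgebra κ Y) : S.Extends S.next.f S.next.p S.next.k :=
  S.exists_extends.choose_spec.choose_spec.choose_spec.choose_spec.choose_spec

/-- The sequence of iterated extensions of a partial coalgebra. -/
noncomputable def iter (S : PartialCoalgebra κ Y) : ℕ → PartialCoalgebra κ Y
  | 0 => S
  | n + 1 => (S.iter n).next

/-- The transition maps between the sources of the iterated extensions. -/
noncomputable def iterHom (S : PartialCoalgebra κ Y) (n : ℕ) :
    (S.iter n).src ⟶ (S.iter (n + 1)).src :=
  (S.iter n).f

/-- A partial coalgebra over `Y` extends to a coalgebra over `Y`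
with `κ`-presentable carrier when `κ` is uncountable. -/
lemma exists_coalgebra (hκ : Cardinal.aleph0 < κ) (S : PartialCoalgebra κ Y) :
    ∃ (Z : c.Coalgebra) (_ : IsCardinalPresentable Z.A κ) (π : Z ⟶ Y) (i : S.tgt ⟶ Z.A),
      i ≫ π.f = S.p ∧ S.k ≫ c.map i = S.f ≫ i ≫ Z.a := by
  have ext (n : ℕ) := (S.iter n).extends_next
  obtain ⟨Z, hZ, π, i, h₁, h₂⟩ := exists_coalgebra_of_sequence hκ
    (b := fun n ↦ (S.iter n).src) (fun n ↦ (S.iter n).presentable_src)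
    (fun n ↦ (S.iter n).f) (fun n ↦ (S.iter n).k) (fun n ↦ (S.iter n).f ≫ (S.iter n).p)
    (fun n ↦ (S.iter n).k_counit) (fun n ↦ (ext n).comm) (fun n ↦ (ext n).coassoc)
    (fun n ↦ congr_arg (fun x ↦ (S.iter n).f ≫ x) (ext n).f_p)
    (fun n ↦ (congr_arg (fun x ↦ (S.iter n).k ≫ c.map x) (ext n).f_p).trans
      ((S.iter n).k_map_p.trans (Category.assoc _ _ _).symm))
  exact ⟨Z, hZ, π, i, h₁.trans (ext 0).f_p, h₂⟩

end PartialCoalgebra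

variable {κ} [IsCardinalLocallyPresentable A κ] [c.toFunctor.IsCardinalAccessible κ]

lemma exists_presentableCarrier_factor (hκ : Cardinal.aleph0 < κ) {Y : c.Coalgebra} {b : A}
    [IsCardinalPresentable b κ] (q : b ⟶ Y.A) :
    ∃ (Z : c.Coalgebra) (_ : c.presentableCarrier κ Z) (π : Z ⟶ Y) (i : b ⟶ Z.A),
      i ≫ π.f = q := by
  obtain ⟨J, _, _, ⟨P⟩⟩ :=
    (isCardinalFilteredGenerator_isCardinalPresentable A κ).exists_colimitsOfShape Y.A
  obtain ⟨j, f, k, hf, hk, hε⟩ := PartialCoalgebra.exists_lift (κ := κ) P.isColimit q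
  obtain ⟨Z, hZ, π, i, hi, -⟩ := PartialCoalgebra.exists_coalgebra hκ
    { src := b
      tgt := P.diag.obj j
      presentable_src := inferInstance
      presentable_tgt := P.prop_diag_obj j
      f := f
      p := P.ι.app j
      k := k
      k_map_p := by rw [hk, reassoc_of% hf]
      k_counit := hε : PartialCoalgebra κ Y }
  exact ⟨Z, hZ, π, f ≫ i, by rw [Category.assoc, hi, hf]⟩

lemma exists_presentableCarrier_coequalizing (hκ : Cardinal.aleph0 < κ) {X Y : c.Coalgebra}
    (hX : c.presentableCarrier κ X) (g : X ⟶ Y) {b : A} [IsCardinalPresentable b κ]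
    (x y : b ⟶ X.A) (hxy : x ≫ g.f = y ≫ g.f) :
    ∃ (Z : c.Coalgebra) (_ : c.presentableCarrier κ Z) (u : X ⟶ Z) (π : Z ⟶ Y),
      u ≫ π = g ∧ x ≫ u.f = y ≫ u.f := by
  have : IsCardinalPresentable X.A κ := hX
  obtain ⟨J, _, _, ⟨P⟩⟩ :=
    (isCardinalFilteredGenerator_isCardinalPresentable A κ).exists_colimitsOfShape Y.A
  have := isFiltered_of_isCardinalFiltered J κ
  have := essentiallySmall_of_small_of_locallySmall.{w} J
  obtain ⟨j₀, f₀, hf₀⟩ := IsCardinalPresentable.exists_hom_of_isColimit κ P.isColimit g.f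
  replace hf₀ : f₀ ≫ P.ι.app j₀ = g.f := hf₀
  obtain ⟨j, v, hv⟩ := IsCardinalPresentable.exists_eq_of_isColimit' κ P.isColimit
    (x ≫ f₀) (y ≫ f₀) (by
      change (x ≫ f₀) ≫ P.ι.app j₀ = (y ≫ f₀) ≫ P.ι.app j₀
      rw [Category.assoc, Category.assoc, hf₀, hxy])
  obtain ⟨f, hf, hf'⟩ : ∃ f : X.A ⟶ P.diag.obj j, f ≫ P.ι.app j = g.f ∧ x ≫ f = y ≫ f :=
    ⟨f₀ ≫ P.diag.map v, by rw [Category.assoc, P.w, hf₀], by simpa using hv⟩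
  have hε := c.ε.naturality f
  dsimp at hε
  obtain ⟨Z, hZ, π, i, hi, hi'⟩ := PartialCoalgebra.exists_coalgebra hκ
    { src := X.A
      tgt := P.diag.obj j
      presentable_src := inferInstance
      presentable_tgt := P.prop_diag_obj j
      f := f
      p := P.ι.app j
      k := X.a ≫ c.map f
      k_map_p := by rw [Category.assoc, ← Functor.map_comp, hf, g.h, reassoc_of% hf]
      k_counit := by rw [Category.assoc, hε, X.counit_assoc] : PartialCoalgebra κ Y }
  dsimp at i hi hi'
  refine ⟨Z, hZ, { f := f ≫ i, h := ?_ }, π, ?_, ?_⟩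
  · rw [Functor.map_comp, ← Category.assoc, hi', Category.assoc]
  · ext
    change (f ≫ i) ≫ π.f = g.f
    rw [Category.assoc, hi, hf]
  · change x ≫ f ≫ i = y ≫ f ≫ i
    rw [reassoc_of% hf']

lemma isStrongGenerator_of_presentableCarrier_le (hκ : Cardinal.aleph0 < κ)
    {Q : ObjectProperty c.Coalgebra} (hQ : c.presentableCarrier κ ≤ Q.isoClosure) :
    Q.IsStrongGenerator := by
  have hA := (isCardinalFilteredGenerator_isCardinalPresentable A κ).isStrongGenerator
  rw [ObjectProperty.isStrongGenerator_iff]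
  refine ⟨fun X Y u v huv ↦ ?_, fun X Y m _ hm ↦ ?_⟩
  · ext
    refine hA.isSeparating _ _ (fun b hb q ↦ ?_)
    have : IsCardinalPresentable b κ := hb
    obtain ⟨Z, hZ, π, i, rfl⟩ := exists_presentableCarrier_factor hκ q
    obtain ⟨Z', hZ', ⟨e⟩⟩ := hQ _ hZ
    have h : π ≫ u = π ≫ v := by
      rw [← cancel_epi e.inv]
      simpa using huv Z' hZ' (e.inv ≫ π)
    simpa using congr_arg (fun φ ↦ i ≫ φ) (congr_arg Coalgebra.Hom.f h)
  · have lift {Z : c.Coalgebra} (hZ : c.presentableCarrier κ Z) (π : Z ⟶ Y) :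
        ∃ φ : Z ⟶ X, φ ≫ m = π := by
      obtain ⟨Z', hZ', ⟨e⟩⟩ := hQ _ hZ
      obtain ⟨φ, hφ⟩ := hm Z' hZ' (e.inv ≫ π)
      exact ⟨e.hom ≫ φ, by simpa using congr_arg (fun ψ ↦ e.hom ≫ ψ) hφ⟩
    have : Mono m.f := by
      rw [hA.isSeparating.mono_iff]
      intro b hb x y hxy
      have : IsCardinalPresentable b κ := hb
      have : HasColimitsOfSize.{0, 0} A := hasColimitsOfSizeShrink.{0, 0, w, w} A
      have : IsCardinalPresentable (b ⨿ b) κ := by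
        have : ∀ j, IsCardinalPresentable ((pair b b).obj j) κ := by
          rintro ⟨_ | _⟩ <;> assumption
        exact isCardinalPresentable_of_isColimit _ (colimit.isColimit (pair b b)) κ
          (hasCardinalLT_of_finite _ _ hκ.le)
      obtain ⟨Z, hZ, π, i, hi⟩ := exists_presentableCarrier_factor hκ (Y := X) (coprod.desc x y)
      have hx : coprod.inl ≫ i ≫ π.f = x := by rw [hi, coprod.inl_desc]
      have hy : coprod.inr ≫ i ≫ π.f = y := by rw [hi, coprod.inr_desc]
      obtain ⟨Z', hZ', u, π', hu, hu'⟩ := exists_presentableCarrier_coequalizing hκ hZ (π ≫ m)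
        (coprod.inl ≫ i) (coprod.inr ≫ i) (by simp [reassoc_of% hx, reassoc_of% hy, hxy])
      obtain ⟨φ, hφ⟩ := lift hZ' π'
      have hπ : u ≫ φ = π := by rw [← cancel_mono m, Category.assoc, hφ, hu]
      have h := congr_arg (fun ψ ↦ ψ ≫ φ.f) hu'
      simpa [← Coalgebra.comp_f, hπ, hx, hy] using h
    have : IsIso m.f := hA.isIso_of_mono _ (fun b hb q ↦ by
      have : IsCardinalPresentable b κ := hb
      obtain ⟨Z, hZ, π, i, hi⟩ := exists_presentableCarrier_factor hκ q
      obtain ⟨φ, hφ⟩ := lift hZ π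
      exact ⟨i ≫ φ.f, by simp [← Coalgebra.comp_f, hφ, hi]⟩)
    exact coalgebra_iso_of_iso c m

variable (c) in
/-- If `κ` is uncountable, the category of coalgebras of a `κ`-accessible comonad on a locally
`κ`-presentable category is locally `κ`-presentable. -/
theorem isCardinalLocallyPresentable_coalgebra (hκ : Cardinal.aleph0 < κ) :
    IsCardinalLocallyPresentable c.Coalgebra κ := by
  have : HasColimitsOfSize.{w, w} c.Coalgebra := hasColimits_of_hasColimits_createsColimits c.forget
  rw [IsCardinalLocallyPresentable.iff_exists_isStrongGenerator]
  obtain ⟨Q, hQ, hQ₁, hQ₂⟩ :=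
    ObjectProperty.EssentiallySmall.exists_small_le (c.presentableCarrier κ)
  refine ⟨Q, hQ, isStrongGenerator_of_presentableCarrier_le hκ hQ₂, fun X hX ↦ ?_⟩
  have : IsCardinalPresentable X.A κ := hQ₁ X hX
  exact c.isCardinalPresentable_coalgebra κ X

end CategoryTheory.Comonad

theorem mainTheorem3 {A : Type u} [Category.{w} A]
    [IsLocallyPresentable.{w} A] (c : Comonad A) [Functor.IsAccessible.{w} c.toFunctor] :
    IsLocallyPresentable.{w} c.Coalgebra := by
  obtain ⟨κ₁, _, _⟩ := IsLocallyPresentable.exists_cardinal.{w} A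
  obtain ⟨κ₂, _, _⟩ := Functor.IsAccessible.exists_cardinal (F := c.toFunctor)
  let κ := (κ₁ ⊔ κ₂) ⊔ Order.succ Cardinal.aleph0
  have hreg : κ.IsRegular :=
    max_rec' _ (max_rec' _ Fact.out Fact.out) (Cardinal.isRegular_succ le_rfl)
  have : Fact κ.IsRegular := ⟨hreg⟩
  have := IsCardinalLocallyPresentable.of_le A (le_sup_left.trans le_sup_left : κ₁ ≤ κ)
  have := c.toFunctor.isCardinalAccessible_of_le (le_sup_right.trans le_sup_left : κ₂ ≤ κ)
  exact ⟨κ, inferInstance, c.isCardinalLocallyPresentable_coalgebra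
    ((Order.lt_succ _).trans_le le_sup_right)⟩
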